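/- A reversible circuit with $N$ inputs is a finite sequence (chain) of gates, each of which is a NOT, a CNOT or a Toffoli gate on the lines $1,\dots,N$: a gate $\mathrm{TOF}(I;t)$ with $I\subseteq\{1,\dots,N\}$, $|I|\le 2$, $t\in\{1,\dots,N\}\setminus I$, maps $\langle x_1,\dots,x_N\rangle\in\{0,1\}^N$ to the vector obtained by replacing $x_t$ with $x_t\oplus\bigwedge_{i\in I}x_i$ (with the empty conjunction equal to $1$). The gate complexity of a circuit is its number of gates. A circuit with $n+q$ inputs implements $f\colon\{0,1\}^n\to\{0,1\}^n$ with $q$ additional inputs if there is a permutation of the $n+q$ output lines such that for every $x\in\{0,1\}^n$ the circuit transforms the input $\langle x_1,\dots,x_n,0,\dots,0\rangle$ into an output whose first $n$ entries, after applying the permutation, are $f(x)$ (the other $q$ outputs are arbitrary). Let $F(n,q)$ be the set of all $f\colon\{0,1\}^n\to\{0,1\}^n$ that can be implemented in this way, let $L(f,q)$ be the minimum gate complexity of a circuit implementing $f\in F(n,q)$ with $q$ additional inputs, and let $L(n,q)=\max_{f\in F(n,q)}L(f,q)$. **Theorem.** Let $\phi,\psi\colon\mathbb N\to\mathbb R$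 be any functions with $\phi(n)\to\infty$ and $\psi(n)\to\infty$ (growing arbitrarily slowly) such that $$\phi(n)\le\frac{n}{\log_2 n+\log_2\psi(n)}$$ for all sufficiently large $n$. Then for every sequence $q_0(n)$ of natural numbers with $$q_0(n)\sim n\,2^{\,n-\lceil n/\phi(n)\rceil}\qquad(n\to\infty)$$ we have $L(n,q_0(n))\lesssim 2^n$, that is, $\limsup_{n\to\infty}L(n,q_0(n))/2^n\le 1$. -/

import Mathlib

namespace ReversibleCircuit

/-- A generalized Toffoli gate `TOF(I; t)` on `N` lines: a set `I` of control lines and a target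
line `t ∉ I`. -/
structure ToffoliGate (N : ℕ) where
  controls : Finset (Fin N)
  target : Fin N
  target_notMem : target ∉ controls

/-- The transformation defined by `TOF(I; t)`: it replaces `x_t` by `x_t ⊕ ⋀_{i ∈ I} x_i` and keeps
every other line. The empty conjunction is `1`, so `TOF(∅; t)` negates `x_t`. -/
def ToffoliGate.apply {N : ℕ} (g : ToffoliGate N) (x : Fin N → Bool) : Fin N → Bool :=
  Function.update x g.target (xor (x g.target) (decide (∀ i ∈ g.controls, x i = true)))

/-- The gate basis on `N` lines: the generalized Toffoli gates with fewer than three control lines,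
that is, all NOT, CNOT and (two-control) Toffoli gates. -/
abbrev BasisGate (N : ℕ) : Type := {g : ToffoliGate N // g.controls.card < 3}

/-- A reversible circuit with `N` inputs: a chain of gates of the basis, the first gate first. -/
abbrev Circuit (N : ℕ) : Type := List (BasisGate N)

/-- The transformation of `𝔹^N` defined by a circuit. -/
def Circuit.run {N : ℕ} (S : Circuit N) (x : Fin N → Bool) : Fin N → Bool :=
  List.foldl (fun y g => g.val.apply y) x S

/-- The gate complexity of a circuit: its number of gates. -/
def Circuit.gateComplexity {N : ℕ} (S : Circuit N) : ℕ := List.length S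

/-- A circuit with `n + q` inputs implements `f : 𝔹^n → 𝔹^n` (with `q` additional inputs) if, for
some fixed permutation `π` of the output lines, every input `⟨x_1, …, x_n, 0, …, 0⟩` is transformed
into an output that reads `⟨f(x)_1, …, f(x)_n, *, …, *⟩` after applying `π`. -/
def Implements {n q : ℕ} (S : Circuit (n + q)) (f : (Fin n → Bool) → (Fin n → Bool)) : Prop :=
  ∃ π : Equiv.Perm (Fin (n + q)), ∀ (x : Fin n → Bool) (i : Fin n),
    S.run (Fin.append x (fun _ : Fin q => false)) (π (Fin.castAdd q i)) = f x i

/-- `F(n, q)`: the transformations `𝔹^n → 𝔹^n` that can be implemented by circuits with `n + q`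
inputs. -/
def implementable (n q : ℕ) : Set ((Fin n → Bool) → (Fin n → Bool)) :=
  {f | ∃ S : Circuit (n + q), Implements S f}

/-- `L(f, q)`: the minimum gate complexity of a circuit implementing `f` with `q` additional inputs
(used for `f ∈ F(n, q)` only, where the minimum exists). -/
noncomputable def complexity {n : ℕ} (f : (Fin n → Bool) → (Fin n → Bool)) (q : ℕ) : ℕ :=
  sInf {l | ∃ S : Circuit (n + q), Implements S f ∧ S.gateComplexity = l}

open Classical in
/-- The Shannon gate complexity function `L(n, q) = max_{f ∈ F(n, q)} L(f, q)`, a maximum over a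
finite set (nonempty, since it contains the identity). -/
noncomputable def shannonComplexity (n q : ℕ) : ℕ :=
  (Finset.univ.filter (fun f => f ∈ implementable n q)).sup (fun f => complexity f q)

/-- `a(n) ≲ b(n)` as `n → ∞`, for eventually positive `b`: `limsup a(n) / b(n) ≤ 1`, that is, for
every `ε > 0`, `a(n) ≤ (1 + ε) b(n)` for all large `n`. -/
def AsympLE (a b : ℕ → ℝ) : Prop :=
  ∀ ε : ℝ, 0 < ε → ∀ᶠ n in Filter.atTop, a n ≤ (1 + ε) * b n

end ReversibleCircuit

/-! The proof is Lupanov's synthesis with `k = ⌈n/φ(n)⌉`. Split the variables into the first `n - k`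
and the last `k`, cut the `2^k` minterms of the last ones into about `2^k/s` groups of at most `s =
n - 2k`, and compute all minterms and all partial sums of each group. Each output is then a sum of
products (minterm of the first variables) · (partial sum of a group), by `exists_products`. A
Toffoli gate multiplies and adds at once, so each product costs one gate and needs no line of its
own (`exists_circuit_sum_products`).

The outputs cost about `n · 2^(n-k) · (2^k/s + 1) = 2^n (n/(n-2k) + n/2^k)` gates; the preparation
costs `O(2^(n-k))` gates and lines. Since `φ → ∞`, `k = o(n)`; the upper bound on `φ` gives `2^k ≥ n
ψ(n)`, so `n/2^k → 0`. -/

namespace ReversibleCircuit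

/-! ### Straight-line computation by sums of products -/

/-- `Builds A K c`: the functions listed in `K` can be computed one after the other, each as a sum
of products of two functions that belong to `A` or precede it in `K`, with at most `c` products
altogether. -/
inductive Builds {X : Type*} : Set (X → Bool) → List (X → Bool) → ℕ → Prop
  | nil (A : Set (X → Bool)) (c : ℕ) : Builds A [] c
  | cons {A : Set (X → Bool)} {K : List (X → Bool)} {c c' : ℕ}
      (P : List ((X → Bool) × (X → Bool))) (hP : ∀ p ∈ P, p.1 ∈ A ∧ p.2 ∈ A)
      (h : Builds (insert (P.map fun p => p.1 * p.2).sum A) K c) (hc : P.length + c ≤ c') :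
      Builds A ((P.map fun p => p.1 * p.2).sum :: K) c'

section Builds

variable {X : Type*}

theorem Builds.mono {A B : Set (X → Bool)} {K : List (X → Bool)} {c c' : ℕ}
    (h : Builds A K c) (hAB : A ⊆ B) (hc : c ≤ c') : Builds B K c' := by
  induction h generalizing B c' with
  | nil A c => exact .nil _ _
  | cons P hP h hc' ih =>
    exact .cons P (fun p hp => ⟨hAB (hP p hp).1, hAB (hP p hp).2⟩)
      (ih (Set.insert_subset_insert hAB) le_rfl) (hc'.trans hc)

theorem Builds.append {A : Set (X → Bool)} {K K' : List (X → Bool)} {c c' : ℕ}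
    (h : Builds A K c) (h' : Builds (A ∪ {f | f ∈ K}) K' c') : Builds A (K ++ K') (c + c') := by
  induction h with
  | nil A c => exact h'.mono (by simp) (by omega)
  | @cons A K c d P hP h hc ih =>
    refine .cons P hP (ih (h'.mono ?_ le_rfl)) (by omega)
    intro f
    simp only [Set.mem_union, Set.mem_ofPred_eq, List.mem_cons, Set.mem_insert_iff]
    tauto

theorem Builds.of_forall {A : Set (X → Bool)} {w : ℕ} (K : List (X → Bool))
    (h : ∀ f ∈ K, ∃ P : List ((X → Bool) × (X → Bool)),
      (∀ p ∈ P, p.1 ∈ A ∧ p.2 ∈ A) ∧ P.length ≤ w ∧ (P.map fun p => p.1 * p.2).sum = f) :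
    Builds A K (K.length * w) := by
  induction K generalizing A with
  | nil => exact .nil _ _
  | cons f K ih =>
    obtain ⟨P, hP, hw, rfl⟩ := h f (by simp)
    refine .cons P hP (ih fun g hg => ?_) (c := K.length * w) (by simp; nlinarith)
    obtain ⟨Q, hQ, hQ'⟩ := h g (by simp [hg])
    exact ⟨Q, fun p hp => ⟨.inr (hQ p hp).1, .inr (hQ p hp).2⟩, hQ'⟩

/-! ### Minterms -/

/-- All products of literals, one literal for each of the given functions. -/
def minterms : List (X → Bool) → List (X → Bool)
  | [] => [1]
  | v :: vs => (minterms vs).map (fun m => m * v) ++ (minterms vs).map (fun m => m + m * v)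

theorem length_minterms (vs : List (X → Bool)) : (minterms vs).length = 2 ^ vs.length := by
  induction vs with
  | nil => rfl
  | cons v vs ih => simp [minterms, ih, pow_succ]; omega

theorem function_add_self (f : X → Bool) : f + f = 0 := by
  funext x
  show xor (f x) (f x) = false
  simp

theorem function_mul_self (f : X → Bool) : f * f = f := by
  funext x
  show (f x && f x) = f x
  simp

theorem sum_minterms (vs : List (X → Bool)) : (minterms vs).sum = 1 := by
  induction vs with
  | nil => simp [minterms]
  | cons v vs ih =>
    have h : ∀ l : List (X → Bool), (l.map (fun m => m * v)).sum = l.sum * v := fun l => by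
      simpa using List.sum_map_mul_right (l := l) (f := id) (r := v)
    rw [minterms, List.sum_append, List.sum_map_add, h, ih, List.map_id', ih, one_mul,
      add_comm (1 : X → Bool), ← add_assoc, function_add_self, zero_add]

theorem sum_minterms_mul (vs : List (X → Bool)) (h : X → Bool) :
    ((minterms vs).map fun m => m * h).sum = h := by
  have := List.sum_map_mul_right (l := minterms vs) (f := id) (r := h)
  simpa [sum_minterms] using this

theorem eq_of_mem_minterms {vs : List (X → Bool)} {m : X → Bool} (hm : m ∈ minterms vs)
    {x y : X} (hx : m x = true) (hy : m y = true) : ∀ v ∈ vs, v x = v y := by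
  induction vs generalizing m with
  | nil => simp
  | cons v vs ih =>
    simp only [minterms, List.mem_append, List.mem_map] at hm
    intro u hu
    rcases hm with ⟨m, hm, rfl⟩ | ⟨m, hm, rfl⟩
    · change (m x && v x) = true at hx
      change (m y && v y) = true at hy
      simp only [Bool.and_eq_true] at hx hy
      rcases List.mem_cons.1 hu with rfl | hu
      · rw [hx.2, hy.2]
      · exact ih hm hx.1 hy.1 u hu
    · change xor (m x) (m x && v x) = true at hx
      change xor (m y) (m y && v y) = true at hy
      have hx' : m x = true ∧ v x = false := by
        revert hx; cases m x <;> cases v x <;> simp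
      have hy' : m y = true ∧ v y = false := by
        revert hy; cases m y <;> cases v y <;> simp
      rcases List.mem_cons.1 hu with rfl | hu
      · rw [hx'.2, hy'.2]
      · exact ih hm hx'.1 hy'.1 u hu

/-- Each new variable doubles the list at no more than two products per new minterm, so the totals
are geometric sums. -/
theorem exists_builds_minterms {A : Set (X → Bool)} (h1 : 1 ∈ A) (vs : List (X → Bool))
    (hvs : ∀ v ∈ vs, v ∈ A) :
    ∃ K, Builds A K (4 * 2 ^ vs.length) ∧ K.length ≤ 2 * 2 ^ vs.length ∧
      ∀ m ∈ minterms vs, m ∈ A ∪ {f | f ∈ K} := by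
  induction vs with
  | nil => exact ⟨[], .nil _ _, by simp, by simpa [minterms] using h1⟩
  | cons v vs ih =>
    obtain ⟨K, hK, hl, hm⟩ := ih fun u hu => hvs u (by simp [hu])
    have hv : v ∈ A ∪ {f | f ∈ K} := .inl (hvs v (by simp))
    refine ⟨K ++ minterms (v :: vs),
      (hK.append (Builds.of_forall (w := 2) _ fun f hf => ?_)).mono subset_rfl ?_, ?_, ?_⟩
    · simp only [minterms, List.mem_append, List.mem_map] at hf
      rcases hf with ⟨m, hm', rfl⟩ | ⟨m, hm', rfl⟩
      · exact ⟨[(m, v)], by simpa using ⟨hm m hm', hv⟩, by simp, by simp⟩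
      -- The negated literal needs no line: `m(1 + v) = m·m + m·v`.
      · refine ⟨[(m, m), (m, v)], ?_, by simp, by simp [function_mul_self]⟩
        intro p hp
        simp only [List.mem_cons, List.not_mem_nil, or_false] at hp
        rcases hp with rfl | rfl
        exacts [⟨hm m hm', hm m hm'⟩, ⟨hm m hm', hv⟩]
    · rw [length_minterms, List.length_cons, pow_succ]; omega
    · rw [List.length_append, length_minterms, List.length_cons, pow_succ]; omega
    · intro m hm'
      exact .inr (List.mem_append_right _ hm')

/-! ### Partial sums of groups and the decomposition -/

/-- All sums of sublists of a list. -/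
def subsetSums : List (X → Bool) → List (X → Bool)
  | [] => [0]
  | g :: gs => subsetSums gs ++ (subsetSums gs).map (fun f => f + g)

theorem length_subsetSums (gs : List (X → Bool)) : (subsetSums gs).length = 2 ^ gs.length := by
  induction gs with
  | nil => rfl
  | cons g gs ih => simp [subsetSums, ih, pow_succ]; omega

theorem builds_subsetSums {A : Set (X → Bool)} (gs : List (X → Bool)) (hgs : ∀ g ∈ gs, g ∈ A) :
    Builds A (subsetSums gs) (2 * 2 ^ gs.length) := by
  induction gs with
  | nil => exact .cons [] (by simp) (.nil _ 0) (by simp)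
  | cons g gs ih =>
    refine ((ih fun u hu => hgs u (by simp [hu])).append
      (Builds.of_forall (w := 2) _ fun f hf => ?_)).mono subset_rfl ?_
    · obtain ⟨m, hm, rfl⟩ := List.mem_map.1 hf
      refine ⟨[(m, m), (g, g)], ?_, by simp, by simp [function_mul_self]⟩
      have := hgs g (by simp)
      simp [this, hm]
    · rw [List.length_map, length_subsetSums, List.length_cons, pow_succ]; omega

theorem sum_map_mem_subsetSums (gs : List (X → Bool)) (φ : (X → Bool) → (X → Bool))
    (hφ : ∀ g ∈ gs, φ g = g ∨ φ g = 0) : (gs.map φ).sum ∈ subsetSums gs := by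
  induction gs with
  | nil => simp [subsetSums]
  | cons g gs ih =>
    have := ih fun u hu => hφ u (by simp [hu])
    rw [List.map_cons, List.sum_cons, subsetSums, List.mem_append]
    rcases hφ g (by simp) with h | h
    · exact .inr (List.mem_map.2 ⟨_, this, by rw [h, add_comm]⟩)
    · exact .inl (by rwa [h, zero_add])

theorem builds_flatMap_subsetSums {A : Set (X → Bool)} {s : ℕ} (C : List (List (X → Bool)))
    (hC : ∀ l ∈ C, l.length ≤ s ∧ ∀ g ∈ l, g ∈ A) :
    Builds A (C.flatMap subsetSums) (C.length * (2 * 2 ^ s)) := by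
  induction C generalizing A with
  | nil => exact .nil _ _
  | cons l C ih =>
    have hl := hC l (by simp)
    have h2 : 2 ^ l.length ≤ 2 ^ s := Nat.pow_le_pow_right (by norm_num) hl.1
    rw [List.flatMap_cons]
    refine ((builds_subsetSums l hl.2).append (ih fun l' hl' => ?_)).mono subset_rfl ?_
    · have := hC l' (by simp [hl'])
      exact ⟨this.1, fun g hg => .inl (this.2 g hg)⟩
    · rw [List.length_cons, add_mul]; omega

theorem length_flatMap_subsetSums_le {s : ℕ} (C : List (List (X → Bool)))
    (hC : ∀ l ∈ C, l.length ≤ s) : (C.flatMap subsetSums).length ≤ C.length * 2 ^ s := by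
  induction C with
  | nil => simp
  | cons l C ih =>
    have h2 : 2 ^ l.length ≤ 2 ^ s := Nat.pow_le_pow_right (by norm_num) (hC l (by simp))
    have := ih fun l' hl' => hC l' (by simp [hl'])
    rw [List.flatMap_cons, List.length_append, List.length_cons, length_subsetSums, add_mul]
    omega

theorem exists_chunks {α : Type*} {s : ℕ} (hs : 0 < s) (l : List α) :
    ∃ C : List (List α), C.flatten = l ∧ (∀ c ∈ C, c.length ≤ s) ∧ C.length * s ≤ l.length + s := by
  induction h : l.length using Nat.strong_induction_on generalizing l with
  | _ m ih =>
    subst h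
    by_cases hl : l.length ≤ s
    · exact ⟨[l], by simp, by simpa using hl, by simp⟩
    · obtain ⟨C, h1, h2, h3⟩ := ih (l.drop s).length (by simp; omega) (l.drop s) rfl
      refine ⟨l.take s :: C, by simp [h1], ?_, ?_⟩
      · intro c hc
        rcases List.mem_cons.1 hc with rfl | hc
        · simp
        · exact h2 c hc
      · rw [List.length_drop] at h3
        rw [List.length_cons, add_mul]
        omega

/-- On the support of a minterm all of `ws` are constant, hence so is `g`. -/
theorem mul_eq_self_or_zero_of_mem_minterms {ws : List (X → Bool)} {g : X → Bool}
    (hg : ∀ x y, (∀ v ∈ ws, v x = v y) → g x = g y) {m : X → Bool} (hm : m ∈ minterms ws) :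
    m * g = m ∨ m * g = 0 := by
  by_cases h : ∃ y, m y = true
  · obtain ⟨y, hy⟩ := h
    have key : ∀ x, m x = true → g x = g y := fun x hx => hg x y (eq_of_mem_minterms hm hx hy)
    cases hb : g y with
    | true =>
      left; funext x
      show (m x && g x) = m x
      cases hx : m x with
      | false => simp
      | true => simp [key x hx, hb]
    | false =>
      right; funext x
      show (m x && g x) = false
      cases hx : m x with
      | false => simp
      | true => simp [key x hx, hb]
  · right; funext x
    show (m x && g x) = false
    have : m x = false := by simpa using not_exists.1 h x
    simp [this]

/-- The decomposition behind the synthesis: a function whose value is determined by the values of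
`vs` and `ws` is a sum of products of a minterm of `vs` and a partial sum of minterms of `ws`. -/
theorem exists_products {vs ws : List (X → Bool)} {C : List (List (X → Bool))}
    (hC : C.flatten = minterms ws) (join : X → X → X)
    (hws : ∀ x y y', (∀ w ∈ ws, w y = w y') → join x y = join x y')
    (hj : ∀ x y, (∀ v ∈ vs, v x = v y) → join y x = x)
    (h : X → Bool) :
    ∃ P : List ((X → Bool) × (X → Bool)),
      (∀ p ∈ P, p.1 ∈ minterms vs ∧ p.2 ∈ C.flatMap subsetSums) ∧
      P.length = 2 ^ vs.length * C.length ∧ (P.map fun p => p.1 * p.2).sum = h := by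
  have key : ∀ m ∈ minterms vs, ∃ g : X → Bool,
      (∀ x y, (∀ v ∈ ws, v x = v y) → g x = g y) ∧ m * g = m * h := by
    intro m hm
    by_cases hy : ∃ y, m y = true
    · obtain ⟨y, hy⟩ := hy
      -- Freeze the `vs`-part at a point `y` of the support of `m`: this does not change `h` on that
      -- support and leaves a function of `ws` only.
      refine ⟨fun x => h (join y x), fun x x' hx => by simp only [hws y x x' hx], ?_⟩
      funext x
      show (m x && h (join y x)) = (m x && h x)
      cases hx : m x with
      | false => simp
      | true => rw [hj x y (eq_of_mem_minterms hm hx hy)]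
    · refine ⟨0, fun _ _ _ => rfl, ?_⟩
      funext x
      have : m x = false := by simpa using not_exists.1 hy x
      show (m x && false) = (m x && h x)
      simp [this]
  choose! g hg hmg using key
  refine ⟨(minterms vs).flatMap fun m => C.map fun c => (m, (c.map fun m' => m' * g m).sum),
    ?_, ?_, ?_⟩
  · intro p hp
    obtain ⟨m, hm, hp⟩ := List.mem_flatMap.1 hp
    obtain ⟨c, hc, rfl⟩ := List.mem_map.1 hp
    refine ⟨hm, List.mem_flatMap.2 ⟨c, hc, sum_map_mem_subsetSums _ _ fun m' hm' => ?_⟩⟩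
    refine mul_eq_self_or_zero_of_mem_minterms (hg m hm) ?_
    rw [← hC]
    exact List.mem_flatten.2 ⟨c, hc, hm'⟩
  · simp [List.length_flatMap, length_minterms]
  · have inner : ∀ m, ((C.map fun c => (m, (c.map fun m' => m' * g m).sum)).map
        fun p : (X → Bool) × (X → Bool) => p.1 * p.2).sum = m * g m := by
      intro m
      rw [List.map_map]
      have h1 := sum_minterms_mul ws (g m)
      rw [← hC, List.map_flatten, List.sum_flatten, List.map_map] at h1
      conv_rhs => rw [← h1]
      rw [← List.sum_map_mul_left]
      rfl
    rw [List.map_flatMap, List.flatMap_def, List.sum_flatten, List.map_map]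
    conv_rhs => rw [← sum_minterms_mul vs h]
    congr 1
    refine List.map_congr_left fun m hm => ?_
    rw [Function.comp_apply, inner, hmg m hm]

end Builds

/-! ### From sums of products to circuits -/

/-- The gate that adds the conjunction of the lines `i` and `j` to the line `t`. -/
def productGate {N : ℕ} (i j t : Fin N) (hi : t ≠ i) (hj : t ≠ j) : BasisGate N :=
  ⟨⟨{i, j}, t, by simp [hi, hj]⟩, (Finset.card_le_two).trans_lt (by norm_num)⟩

/-- The case `i = j` is allowed and gives a CNOT; it realizes the products `f * f = f`. -/
theorem productGate_apply {N : ℕ} (i j t : Fin N) (hi : t ≠ i) (hj : t ≠ j) (x : Fin N → Bool) :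
    (productGate i j t hi hj).val.apply x = Function.update x t (x t + x i * x j) := by
  have : decide (∀ l ∈ ({i, j} : Finset (Fin N)), x l = true) = (x i && x j) := by simp
  exact congrArg (fun b => Function.update x t (xor (x t) b)) this

/-- The gate that negates the line `t`. -/
def notGate {N : ℕ} (t : Fin N) : BasisGate N :=
  ⟨⟨∅, t, by simp⟩, by simp⟩

theorem notGate_apply {N : ℕ} (t : Fin N) (x : Fin N → Bool) :
    (notGate t).val.apply x = Function.update x t (x t + 1) := by
  have : decide (∀ l ∈ (∅ : Finset (Fin N)), x l = true) = true := by simp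
  exact congrArg (fun b => Function.update x t (xor (x t) b)) this

theorem Circuit.run_append {N : ℕ} (S T : Circuit N) (x : Fin N → Bool) :
    Circuit.run (S ++ T) x = T.run (S.run x) :=
  List.foldl_append

/-- `Realizes u L c`: some circuit with at most `c` gates turns every input `u x` into the values
at `x` of the functions listed in `L`, followed by zeros. -/
def Realizes {X : Type*} {N : ℕ} (u : X → Fin N → Bool) (L : List (X → Bool)) (c : ℕ) : Prop :=
  ∃ S : Circuit N, S.length ≤ c ∧ ∀ x i, S.run (u x) i = L.getD i 0 x

section Realizes

variable {X : Type*} {N : ℕ}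

/-- All controls lie on lines below `t`, so the accumulation on `t` never disturbs what is read. The
content of `t` is left arbitrary for the induction. -/
theorem exists_circuit_sum_products (L : List (X → Bool)) (t : Fin N) (ht : L.length = t)
    (P : List ((X → Bool) × (X → Bool))) (hP : ∀ p ∈ P, p.1 ∈ L ∧ p.2 ∈ L) :
    ∃ S : Circuit N, S.length = P.length ∧ ∀ (x : X) (y : Fin N → Bool),
      (∀ i, i ≠ t → y i = L.getD i 0 x) →
      S.run y = Function.update y t (y t + (P.map fun p => p.1 * p.2).sum x) := by
  induction P with
  | nil =>
    refine ⟨[], rfl, fun x y _ => ?_⟩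
    show y = _
    simp
  | cons p P ih =>
    obtain ⟨S, hS, hrun⟩ := ih fun p hp => hP p (by simp [hp])
    obtain ⟨h1, h2⟩ := hP p (by simp)
    obtain ⟨i, hi, hpi⟩ := List.getElem_of_mem h1
    obtain ⟨j, hj, hpj⟩ := List.getElem_of_mem h2
    have hti : t ≠ ⟨i, by omega⟩ := fun h => by
      have := congrArg Fin.val h; simp at this; omega
    have htj : t ≠ ⟨j, by omega⟩ := fun h => by
      have := congrArg Fin.val h; simp at this; omega
    refine ⟨productGate ⟨i, by omega⟩ ⟨j, by omega⟩ t hti htj :: S, by simp [hS], fun x y hy => ?_⟩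
    have hyi := hy _ hti.symm
    have hyj := hy _ htj.symm
    rw [List.getD_eq_getElem _ _ hi, hpi] at hyi
    rw [List.getD_eq_getElem _ _ hj, hpj] at hyj
    show Circuit.run S ((productGate _ _ t hti htj).val.apply y) = _
    rw [productGate_apply, hyi, hyj, hrun x _ fun l hl => by rw [Function.update_of_ne hl, hy l hl]]
    rw [Function.update_idem, Function.update_self, List.map_cons, List.sum_cons, Pi.add_apply,
      Pi.mul_apply, add_assoc]

theorem update_eq_getD_append {L : List (X → Bool)} {t : Fin N} (ht : L.length = t) {x : X}
    {y : Fin N → Bool} (hy : ∀ i : Fin N, y i = L.getD i 0 x) (f : X → Bool) (i : Fin N) :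
    Function.update y t (y t + f x) i = (L ++ [f]).getD i 0 x := by
  have hyt : y t = false := by
    rw [hy t, List.getD_eq_default _ _ ht.le]; rfl
  by_cases hi : i = t
  · subst hi
    rw [Function.update_self, hyt, List.getD_append_right _ _ _ _ ht.le]
    simp only [ht, Nat.sub_self, List.getD_cons_zero]
    exact Bool.false_xor _
  · rw [Function.update_of_ne hi, hy i]
    have hne : (i : ℕ) ≠ L.length := fun h => hi (Fin.ext (h.trans ht))
    rcases lt_or_gt_of_ne hne with h | h
    · rw [List.getD_append _ _ _ _ h]
    · rw [List.getD_eq_default _ _ h.le, List.getD_eq_default _ _ (by simp; omega)]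

theorem Realizes.append_sum {u : X → Fin N → Bool} {L : List (X → Bool)} {c : ℕ}
    (h : Realizes u L c) (hN : L.length < N) (P : List ((X → Bool) × (X → Bool)))
    (hP : ∀ p ∈ P, p.1 ∈ L ∧ p.2 ∈ L) :
    Realizes u (L ++ [(P.map fun p => p.1 * p.2).sum]) (c + P.length) := by
  obtain ⟨S, hS, hrun⟩ := h
  obtain ⟨T, hT, hrun'⟩ := exists_circuit_sum_products (N := N) L ⟨L.length, hN⟩ rfl P hP
  refine ⟨S ++ T, by rw [List.length_append]; omega, fun x i => ?_⟩
  rw [Circuit.run_append, hrun' x _ fun i _ => hrun x i]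
  exact update_eq_getD_append rfl (hrun x) _ i

theorem Realizes.append_one {u : X → Fin N → Bool} {L : List (X → Bool)} {c : ℕ}
    (h : Realizes u L c) (hN : L.length < N) : Realizes u (L ++ [1]) (c + 1) := by
  obtain ⟨S, hS, hrun⟩ := h
  refine ⟨S ++ [notGate ⟨L.length, hN⟩], by simpa using hS, fun x i => ?_⟩
  rw [Circuit.run_append]
  show (notGate _).val.apply _ i = _
  rw [notGate_apply]
  exact update_eq_getD_append rfl (hrun x) 1 i

theorem Realizes.append_of_builds {u : X → Fin N → Bool} {L K : List (X → Bool)} {c d : ℕ}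
    (h : Realizes u L c) {A : Set (X → Bool)} (hK : Builds A K d) (hA : ∀ f ∈ A, f ∈ L)
    (hN : L.length + K.length ≤ N) : Realizes u (L ++ K) (c + d) := by
  induction hK generalizing L c with
  | nil A d =>
    obtain ⟨S, hS, hrun⟩ := h
    exact ⟨S, by omega, by simpa using hrun⟩
  | @cons A K e d P hP hK hd ih =>
    rw [List.length_cons] at hN
    have := ih (h.append_sum (by omega) P fun p hp => ⟨hA _ (hP p hp).1, hA _ (hP p hp).2⟩)
      (fun f hf => by
        rcases hf with rfl | hf
        · simp
        · simp [hA f hf]) (by simp; omega)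
    obtain ⟨S, hS, hrun⟩ := this
    exact ⟨S, by omega, by simpa using hrun⟩

end Realizes

/-! ### The bound for a single transformation -/

/-- The coordinate functions on `𝔹^n`. -/
def coordinates (n : ℕ) : List ((Fin n → Bool) → Bool) :=
  List.ofFn fun i x => x i

theorem realizes_coordinates (n q : ℕ) :
    Realizes (fun x : Fin n → Bool => (Fin.append x fun _ : Fin q => false : Fin (n + q) → Bool))
      (coordinates n) 0 := by
  refine ⟨[], le_rfl, fun x i => ?_⟩
  show (Fin.append x fun _ : Fin q => false : Fin (n + q) → Bool) i = _
  refine Fin.addCases (fun i => ?_) (fun i => ?_) i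
  · rw [Fin.append_left, List.getD_eq_getElem _ _ (by simp [coordinates])]
    exact (congrFun (List.getElem_ofFn (f := fun i (x : Fin n → Bool) => x i) _) x).symm
  · rw [Fin.append_right, List.getD_eq_default _ _ (by simp [coordinates])]
    rfl

theorem complexity_le_of_realizes {n q c : ℕ} {f : (Fin n → Bool) → (Fin n → Bool)}
    {L : List ((Fin n → Bool) → Bool)} (hL : L.length + n ≤ n + q)
    (h : Realizes (fun x : Fin n → Bool =>
      (Fin.append x fun _ : Fin q => false : Fin (n + q) → Bool))
      (L ++ List.ofFn fun i x => f x i) c) :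
    complexity f q ≤ c := by
  obtain ⟨S, hS, hrun⟩ := h
  let e : Fin n → Fin (n + q) := fun i => ⟨L.length + i, by omega⟩
  have he : Function.Injective e := fun i j hij => by
    have := congrArg Fin.val hij
    simp only [e] at this
    exact Fin.ext (by omega)
  -- An injection of the output positions extends to a permutation of the finite set of lines.
  obtain ⟨π, hπ⟩ : ∃ π : Equiv.Perm (Fin (n + q)), ∀ i, π (Fin.castAdd q i) = e i := by
    let a := Equiv.ofInjective (Fin.castAdd q : Fin n → Fin (n + q)) (Fin.castAdd_injective n q)
    let b := Equiv.ofInjective e he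
    refine ⟨(a.symm.trans b).extendSubtype, fun i => ?_⟩
    refine (Equiv.extendSubtype_apply_of_mem _ _ (Set.mem_range_self i)).trans ?_
    have : a.symm ⟨Fin.castAdd q i, Set.mem_range_self i⟩ = i := a.symm_apply_apply i
    rw [Equiv.trans_apply, this]
    rfl
  have himp : Implements S f := by
    refine ⟨π, fun x i => ?_⟩
    rw [hπ, hrun]
    simp only [e]
    rw [List.getD_append_right _ _ _ _ (by omega), List.getD_eq_getElem _ _ (by simp)]
    simp
  exact (Nat.sInf_le ⟨S, himp, rfl⟩ : complexity f q ≤ S.length).trans hS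

/-- Lupanov's synthesis with the first `r` and the last `k` variables separated and the minterms of
the last variables split into `p` groups of at most `s`. -/
theorem complexity_le {r k s q : ℕ} (hs : 0 < s)
    (f : (Fin (r + k) → Bool) → (Fin (r + k) → Bool)) (p : ℕ) (hp : 2 ^ k + s < (p + 1) * s)
    (hq : (r + k) + 1 + 2 * 2 ^ r + 2 * 2 ^ k + p * 2 ^ s ≤ q) :
    complexity f q ≤
      1 + 4 * 2 ^ r + 4 * 2 ^ k + p * (2 * 2 ^ s) + (r + k) * (2 ^ r * p) := by
  let vs : List ((Fin (r + k) → Bool) → Bool) := List.ofFn fun (i : Fin r) x => x (Fin.castAdd k i)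
  let ws : List ((Fin (r + k) → Bool) → Bool) := List.ofFn fun (i : Fin k) x => x (Fin.natAdd r i)
  have hvl : vs.length = r := by simp [vs]
  have hwl : ws.length = k := by simp [ws]
  obtain ⟨C, hC, hCs, hCl⟩ := exists_chunks hs (minterms ws)
  rw [length_minterms, hwl] at hCl
  have hCp : C.length ≤ p := by
    by_contra! h
    have := Nat.mul_le_mul_right s (Nat.succ_le_of_lt h)
    rw [Nat.succ_eq_add_one] at this
    omega
  have hCp2 : C.length * 2 ^ s ≤ p * 2 ^ s := Nat.mul_le_mul_right _ hCp
  -- The constant `1` is the empty minterm, where the minterm construction starts.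
  let L₀ := coordinates (r + k) ++ [1]
  have hL₀ : L₀.length = r + k + 1 := by simp [L₀, coordinates]
  have hcoord : ∀ i : Fin (r + k), (fun x : Fin (r + k) → Bool => x i) ∈ L₀ := fun i =>
    List.mem_append_left _ (List.mem_ofFn.2 ⟨i, rfl⟩)
  have h₀ : Realizes _ L₀ (0 + 1) := (realizes_coordinates (r + k) q).append_one (by simp [coordinates]; omega)
  obtain ⟨K₁, hK₁, hl₁, hm₁⟩ := exists_builds_minterms (A := {g | g ∈ L₀}) (by simp [L₀]) vs
    (fun v hv => by obtain ⟨i, rfl⟩ := List.mem_ofFn.1 hv; exact hcoord _)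
  obtain ⟨K₂, hK₂, hl₂, hm₂⟩ := exists_builds_minterms (A := {g | g ∈ L₀}) (by simp [L₀]) ws
    (fun v hv => by obtain ⟨i, rfl⟩ := List.mem_ofFn.1 hv; exact hcoord _)
  rw [hvl] at hK₁ hl₁
  rw [hwl] at hK₂ hl₂
  let K₃ := C.flatMap subsetSums
  have hl₃ : K₃.length ≤ C.length * 2 ^ s := length_flatMap_subsetSums_le C hCs
  have hK₃ : Builds ({g | g ∈ L₀} ∪ {g | g ∈ K₂}) K₃ (C.length * (2 * 2 ^ s)) :=
    builds_flatMap_subsetSums C fun c hc => ⟨hCs c hc, fun g hg =>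
      hm₂ g (hC ▸ List.mem_flatten.2 ⟨c, hc, hg⟩)⟩
  let K₄ : List ((Fin (r + k) → Bool) → Bool) := List.ofFn fun i x => f x i
  have hK₄ : Builds ({g | g ∈ L₀} ∪ {g | g ∈ K₁} ∪ {g | g ∈ K₃}) K₄
      (K₄.length * (2 ^ r * C.length)) := by
    refine Builds.of_forall _ fun g _ => ?_
    let join : (Fin (r + k) → Bool) → (Fin (r + k) → Bool) → (Fin (r + k) → Bool) := fun x y =>
      (Fin.append (fun i : Fin r => x (Fin.castAdd k i)) (fun i : Fin k => y (Fin.natAdd r i)) :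
        Fin (r + k) → Bool)
    obtain ⟨P, hP, hPl, hPs⟩ := exists_products (vs := vs) hC join
      (fun x y y' hy => by
        have : (fun i : Fin k => y (Fin.natAdd r i)) = fun i : Fin k => y' (Fin.natAdd r i) :=
          funext fun i => hy _ (List.mem_ofFn.2 ⟨i, rfl⟩)
        simp only [join, this])
      (fun x y hx => by
        funext i
        refine Fin.addCases (fun i => ?_) (fun i => ?_) i
        · exact (Fin.append_left _ _ i).trans (hx _ (List.mem_ofFn.2 ⟨i, rfl⟩)).symm
        · exact Fin.append_right _ _ i) g
    refine ⟨P, fun p hp => ⟨.inl (hm₁ _ (hP p hp).1), .inr (hP p hp).2⟩, ?_, hPs⟩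
    rw [hPl, hvl]
  have hl₄ : K₄.length = r + k := by simp [K₄]
  have h₁ := h₀.append_of_builds hK₁ (fun _ h => h) (by omega)
  have h₂ := h₁.append_of_builds hK₂ (fun _ h => List.mem_append_left _ h)
    (by rw [List.length_append]; omega)
  have h₃ := h₂.append_of_builds hK₃ (fun g h => by
      rcases h with h | h
      · exact List.mem_append_left _ (List.mem_append_left _ h)
      · exact List.mem_append_right _ h)
    (by rw [List.length_append, List.length_append]; omega)
  have h₄ := h₃.append_of_builds hK₄ (fun g h => by
      rcases h with (h | h) | h
      · exact List.mem_append_left _ (List.mem_append_left _ (List.mem_append_left _ h))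
      · exact List.mem_append_left _ (List.mem_append_left _ (List.mem_append_right _ h))
      · exact List.mem_append_right _ h)
    (by rw [List.length_append, List.length_append, List.length_append]; omega)
  refine (complexity_le_of_realizes ?_ h₄).trans ?_
  · rw [List.length_append, List.length_append, List.length_append]
    omega
  · have h5 : C.length * (2 * 2 ^ s) ≤ p * (2 * 2 ^ s) := Nat.mul_le_mul_right _ hCp
    have h6 : (r + k) * (2 ^ r * C.length) ≤ (r + k) * (2 ^ r * p) :=
      Nat.mul_le_mul_left _ (Nat.mul_le_mul_left _ hCp)
    rw [hl₄]
    omega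

theorem shannonComplexity_le {n q c : ℕ}
    (h : ∀ f : (Fin n → Bool) → (Fin n → Bool), complexity f q ≤ c) :
    shannonComplexity n q ≤ c :=
  Finset.sup_le fun f _ => h f

/-! ### Choice of parameters and asymptotics -/

/-- The synthesis bound with `s = n - 2 * k`, in units of `2 ^ n`. -/
theorem shannonComplexity_div_le {n k q : ℕ} (hn : 40 ≤ n) (hk : 4 * k ≤ n) (hnk : n ≤ 2 ^ k)
    (hq : (n : ℝ) * 2 ^ (n - k) / 2 ≤ q) :
    (shannonComplexity n q : ℝ) ≤
      ((n : ℝ) / (n - 2 * k) + n / 2 ^ k + 13 / 2 ^ k) * 2 ^ n := by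
  obtain ⟨r, rfl⟩ : ∃ r, n = r + k := ⟨n - k, by omega⟩
  obtain ⟨s, rfl⟩ : ∃ s, r = s + k := ⟨r - k, by omega⟩
  have hs : 0 < s := by omega
  set p := 2 ^ k / s + 1 with hp
  have hp1 : 2 ^ k + s < (p + 1) * s := by
    have := Nat.lt_div_mul_add (a := 2 ^ k) hs
    rw [hp]; nlinarith
  have hp2 : p ≤ 2 ^ k := by
    have h2 : 2 ≤ s := by omega
    have h3 : 2 ^ k / s ≤ 2 ^ k / 2 := Nat.div_le_div_left h2 (by norm_num)
    omega
  have hps : p * 2 ^ s ≤ 2 ^ (s + k) := by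
    rw [pow_add, mul_comm (2 ^ s)]
    exact Nat.mul_le_mul_right _ hp2
  have hks : 2 ^ k ≤ 2 ^ (s + k) := Nat.pow_le_pow_right (by norm_num) (by omega)
  -- As `n ≥ 40`, half of `n * 2^(n-k)` is at least `20 * 2^(n-k)`, while every summand is a small
  -- multiple of `2^(n-k)`.
  have hq' : (s + k + k) + 1 + 2 * 2 ^ (s + k) + 2 * 2 ^ k + p * 2 ^ s ≤ q := by
    have e : s + k + k - k = s + k := by omega
    rw [e] at hq
    have h4 : (40 : ℝ) * 2 ^ (s + k) / 2 ≤ q := by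
      refine le_trans ?_ hq
      have : (40 : ℝ) ≤ ((s + k + k : ℕ) : ℝ) := by exact_mod_cast hn
      gcongr
    have h5 : 20 * 2 ^ (s + k) ≤ q := by
      have : ((20 * 2 ^ (s + k) : ℕ) : ℝ) ≤ q := by push_cast; linarith
      exact_mod_cast this
    omega
  have hmain := shannonComplexity_le fun f => complexity_le hs f p hp1 hq'
  have hR : (shannonComplexity (s + k + k) q : ℝ) ≤
      1 + 4 * 2 ^ (s + k) + 4 * 2 ^ k + p * (2 * 2 ^ s) + (s + k + k) * (2 ^ (s + k) * p) := by
    exact_mod_cast hmain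
  have hpR : (p : ℝ) ≤ 2 ^ k / s + 1 := by
    rw [hp]; push_cast
    have : ((2 ^ k / s : ℕ) : ℝ) ≤ ((2 ^ k : ℕ) : ℝ) / s := Nat.cast_div_le
    push_cast at this
    linarith
  have hpsR : (p : ℝ) * 2 ^ s ≤ 2 ^ (s + k) := by exact_mod_cast hps
  have hksR : (2 : ℝ) ^ k ≤ 2 ^ (s + k) := by exact_mod_cast hks
  have h1 : (1 : ℝ) ≤ 2 ^ (s + k) := one_le_pow₀ (by norm_num)
  have hlast : ((s : ℝ) + k + k) * (2 ^ (s + k) * p) ≤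
      (s + k + k) * (2 ^ (s + k) * (2 ^ k / s + 1)) := by gcongr
  have hsR : (0 : ℝ) < s := by exact_mod_cast hs
  have hk0 : (0 : ℝ) < 2 ^ k := by positivity
  -- The preparatory terms total at most `11 * 2^(s+k)`, so the constant 13 leaves slack.
  have hrhs : (((s + k + k : ℕ) : ℝ) / ((s + k + k : ℕ) - 2 * k) + (s + k + k : ℕ) / 2 ^ k +
      13 / 2 ^ k) * 2 ^ (s + k + k) =
      (s + k + k) * (2 ^ (s + k) * (2 ^ k / s + 1)) + 13 * 2 ^ (s + k) := by
    push_cast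
    have : (s : ℝ) + k + k - 2 * k = s := by ring
    rw [this, pow_add 2 (s + k) k]
    field_simp
  rw [hrhs]
  nlinarith

/-- The exponent `⌈n / φ(n)⌉` is eventually a natural number `k` with `n B ≤ 2 ^ k` and
`k ≤ δ n`. -/
theorem eventually_ceil_div {φ ψ : ℕ → ℝ}
    (hφ : Filter.Tendsto φ Filter.atTop Filter.atTop)
    (hψ : Filter.Tendsto ψ Filter.atTop Filter.atTop)
    (hφψ : ∀ᶠ n : ℕ in Filter.atTop,
      φ n ≤ (n : ℝ) / (Real.logb 2 (n : ℝ) + Real.logb 2 (ψ n)))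
    {δ B : ℝ} (hδ : 0 < δ) (hB : 1 ≤ B) :
    ∀ᶠ n : ℕ in Filter.atTop, ∃ k : ℕ,
      ⌈(n : ℝ) / φ n⌉ = k ∧ (n : ℝ) * B ≤ 2 ^ k ∧ (k : ℝ) ≤ δ * n := by
  filter_upwards [hφ.eventually_ge_atTop (max 1 (2 / δ)), hψ.eventually_ge_atTop B, hφψ,
    Filter.eventually_ge_atTop 2,
    (tendsto_natCast_atTop_atTop (R := ℝ)).eventually_ge_atTop (2 / δ)] with n h1 h2 h3 hn h4
  have hn' : (2 : ℝ) ≤ n := by exact_mod_cast hn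
  have hφ0 : 0 < φ n := by linarith [le_max_left 1 (2 / δ)]
  have hφδ : 2 / δ ≤ φ n := (le_max_right _ _).trans h1
  have hψ0 : 0 < ψ n := by linarith
  have hpos : 0 ≤ (n : ℝ) / φ n := by positivity
  refine ⟨⌈(n : ℝ) / φ n⌉.toNat, (Int.toNat_of_nonneg (Int.ceil_nonneg hpos)).symm, ?_, ?_⟩
  · have hlog : 0 < Real.logb 2 (n : ℝ) + Real.logb 2 (ψ n) :=
      add_pos_of_pos_of_nonneg (Real.logb_pos (by norm_num) (by linarith))
        (Real.logb_nonneg (by norm_num) (by linarith))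
    have hle : Real.logb 2 ((n : ℝ) * ψ n) ≤ (⌈(n : ℝ) / φ n⌉.toNat : ℝ) := by
      rw [Real.logb_mul (by positivity) hψ0.ne']
      rw [le_div_iff₀ hlog, mul_comm, ← le_div_iff₀ hφ0] at h3
      exact h3.trans (Nat.le_ceil _)
    rw [Real.logb_le_iff_le_rpow (by norm_num) (by positivity), Real.rpow_natCast] at hle
    refine le_trans ?_ hle
    gcongr
  · have h5 : (⌈(n : ℝ) / φ n⌉.toNat : ℝ) < (n : ℝ) / φ n + 1 := Nat.ceil_lt_add_one hpos
    have h6 : (n : ℝ) / φ n ≤ δ / 2 * n := by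
      rw [div_le_iff₀ hφ0]
      rw [div_le_iff₀ hδ] at hφδ
      nlinarith
    have h7 : 1 ≤ δ / 2 * n := by
      rw [div_le_iff₀ hδ] at h4
      linarith
    linarith

end ReversibleCircuit

theorem mainTheorem1 (φ ψ : ℕ → ℝ)
    (hφ : Filter.Tendsto φ Filter.atTop Filter.atTop)
    (hψ : Filter.Tendsto ψ Filter.atTop Filter.atTop)
    (hφψ : ∀ᶠ n : ℕ in Filter.atTop,
      φ n ≤ (n : ℝ) / (Real.logb 2 (n : ℝ) + Real.logb 2 (ψ n)))
    (q₀ : ℕ → ℕ)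
    (hq₀ : Asymptotics.IsEquivalent Filter.atTop (fun n : ℕ => (q₀ n : ℝ))
      (fun n : ℕ => (n : ℝ) * (2 : ℝ) ^ ((n : ℤ) - ⌈(n : ℝ) / φ n⌉))) :
    ReversibleCircuit.AsympLE
      (fun n : ℕ => (ReversibleCircuit.shannonComplexity n (q₀ n) : ℝ))
      (fun n : ℕ => (2 : ℝ) ^ n) := by
  intro ε hε
  -- With `k ≤ δn`, `2k(1 + ε/3) ≤ εn/6 + εn/6`, which is `n/(n-2k) ≤ 1 + ε/3`; the bound `1/4` also
  -- gives `4k ≤ n`.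
  set δ : ℝ := min (ε / 12) (1 / 4) with hδ
  have hδ0 : 0 < δ := by positivity
  have hδε : δ ≤ ε / 12 := min_le_left _ _
  have hδ4 : δ ≤ 1 / 4 := min_le_right _ _
  -- `B ≥ 3/ε` makes `n/2^k ≤ ε/3`, and `2^k ≥ n ≥ 39/ε` makes `13/2^k ≤ ε/3`. Of the equivalence
  -- only `q₀ ≥ n * 2^(n-k) / 2` is needed.
  filter_upwards [ReversibleCircuit.eventually_ceil_div hφ hψ hφψ (B := max 1 (3 / ε)) hδ0
      (le_max_left _ _),
    (Asymptotics.isLittleO_iff.1 hq₀.isLittleO) (c := 1 / 2) (by norm_num),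
    Filter.eventually_ge_atTop 40,
    (tendsto_natCast_atTop_atTop (R := ℝ)).eventually_ge_atTop (39 / ε)] with n hk hq hn hnε
  obtain ⟨k, hkc, hkB, hkδ⟩ := hk
  have hn' : (40 : ℝ) ≤ n := by exact_mod_cast hn
  have hk4 : 4 * k ≤ n := by
    have : (4 : ℝ) * k ≤ n := by nlinarith
    exact_mod_cast this
  have hnk : (n : ℝ) ≤ 2 ^ k :=
    le_trans (le_mul_of_one_le_right (by positivity) (le_max_left _ _)) hkB
  have hkB' : (n : ℝ) * (3 / ε) ≤ 2 ^ k := le_trans (by gcongr; exact le_max_right _ _) hkB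
  have hpow : (2 : ℝ) ^ ((n : ℤ) - ⌈(n : ℝ) / φ n⌉) = 2 ^ (n - k) := by
    rw [hkc, ← Nat.cast_sub (by omega), zpow_natCast]
  simp only [Pi.sub_apply, hpow] at hq
  rw [Real.norm_eq_abs, Real.norm_of_nonneg (by positivity)] at hq
  have hq' : (n : ℝ) * 2 ^ (n - k) / 2 ≤ q₀ n := by
    have := (abs_le.1 hq).1
    linarith
  refine (ReversibleCircuit.shannonComplexity_div_le hn hk4 (by exact_mod_cast hnk) hq').trans ?_
  have hk0 : (0 : ℝ) < 2 ^ k := by positivity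
  have e1 : (n : ℝ) / (n - 2 * k) ≤ 1 + ε / 3 := by
    have h1 : (k : ℝ) ≤ ε / 12 * n := hkδ.trans (by gcongr)
    have h2 : (k : ℝ) ≤ 1 / 4 * n := hkδ.trans (by gcongr)
    have h3 : ε * k ≤ ε * (1 / 4 * n) := by gcongr
    rw [div_le_iff₀ (by linarith)]
    linarith
  have e2 : (n : ℝ) / 2 ^ k ≤ ε / 3 := by
    rw [div_le_iff₀ hk0]
    have : (n : ℝ) = ε / 3 * (n * (3 / ε)) := by field_simp
    rw [this]
    gcongr
  have e3 : (13 : ℝ) / 2 ^ k ≤ ε / 3 := by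
    rw [div_le_iff₀ hk0]
    rw [div_le_iff₀ hε] at hnε
    nlinarith
  exact mul_le_mul_of_nonneg_right (by linarith) (by positivity)
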